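/- Let $R$ be a commutative ring with identity and let $M$ be a nonzero $R$-module. For a finite sequence ${\bf x}=x_1,\dots,x_\ell$ in $R$ write $\ell({\bf x})=\ell$ and ${\bf x}^n=x_1^n,\dots,x_\ell^n$; let $H_i({\bf x},M)$ be the homology of the Koszul complex $K_\bullet({\bf x},M)=K_\bullet(x_1,R)\otimes_R\cdots\otimes_R K_\bullet(x_\ell,R)\otimes_R M$, and let $H^i_{\bf x}(M)$ be the cohomology of the Čech complex $C(x_1)\otimes_R\cdots\otimes_R C(x_\ell)\otimes_R M$, where $C(x)$ is $0\to R\to R_x\to 0$. The sequence ${\bf x}$ is called *$M$-weakly proregular* if for each $n$ there is $m\ge n$ such that the map $H_i({\bf x}^m,M)\to H_i({\bf x}^n,M)$ is zero for all $i\ge1$; this map is induced by the tensor product over $j$ of the chain maps $K_\bullet(x_j^m,R)\to K_\bullet(x_j^n,R)$ that are multiplication by $x_j^{m-n}$ in degree $1$ and the identity in degree $0$. It is a *parameter sequence on $M$* if it is $M$-weakly proregular, ${\bf x}M\ne M$, and $H^{\ell({\bf x})}_{\bf x}(M)_{\mathfrak p}\neq0$ for every prime $\mathfrak p\in\operatorname{Supp}_R(M/{\bf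 x}M)$. It is a *strong parameter sequence on $M$* if $x_1,\dots,x_i$ is a parameter sequence on $M$ for each $i=1,\dots,\ell({\bf x})$ (in particular, the empty sequence is one). A sequence ${\bf x}$ is *weak $M$-regular* if $x_i$ is a non-zero-divisor on $M/(x_1,\dots,x_{i-1})M$ for $i=1,\dots,\ell$, and *$M$-regular* if moreover ${\bf x}M\neq M$. For an ideal $I$ of $R$, $\operatorname{grade}(I,M)\in\mathbb N\cup\{\infty\}$ is the supremum of the lengths of weak $M$-regular sequences contained in $I$, and $$\operatorname{p-grade}_R(I,M)=\lim_{m\to\infty}\operatorname{grade}\bigl(IR[t_1,\dots,t_m],\,R[t_1,\dots,t_m]\otimes_R M\bigr).$$ Then the following are equivalent: 1. $M$ is Cohen-Macaulay, i.e. every strong parameter sequence on $M$ is an $M$-regular sequence. 2. $\operatorname{grade}({\bf x}R,M)=\ell({\bf x})$ for every strong parameter sequence ${\bf x}$ on $M$. 3. $\operatorname{p-grade}_R({\bf x}R,M)=\ell({\bf x})$ for every strong parameter sequence ${\bf x}$ on $M$. 4. $H_i({\bf x},M)=0$ for all $i\ge1$ and every strong parameter sequence ${\bf x}$ on $M$.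 5. $H^i_{\bf x}(M)=0$ for all $i<\ell({\bf x})$ and every strong parameter sequence ${\bf x}$ on $M$. -/

import Mathlib

open CategoryTheory Filter Topology
open scoped TensorProduct

noncomputable section

namespace NonNoethCM

universe u v

variable {R : Type u} [CommRing R] {l : ℕ}

/-- The subsets of `{0, …, l - 1}` with exactly `i` elements. -/
abbrev Idx (l i : ℕ) : Type := {S : Finset (Fin l) // S.card = i}

/-- `(-1) ^ #{k ∈ S | k < j}`. -/
def sgn (S : Finset (Fin l)) (j : Fin l) : ℤ :=
  (-1) ^ (S.filter (· < j)).card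

lemma sgn_insert (S : Finset (Fin l)) {j : Fin l} (hj : j ∉ S) (k : Fin l) :
    sgn (insert j S) k = (if j < k then -1 else 1) * sgn S k := by
  unfold sgn
  rw [Finset.filter_insert]
  split_ifs with h
  · rw [Finset.card_insert_of_notMem (by simp [hj]), pow_succ']
  · simp

lemma sgn_swap (S : Finset (Fin l)) {j k : Fin l} (hj : j ∉ S) (hk : k ∉ S) (hjk : j ≠ k) :
    sgn S j * sgn (insert j S) k + sgn S k * sgn (insert k S) j = 0 := by
  rw [sgn_insert S hj, sgn_insert S hk]
  rcases lt_or_gt_of_ne hjk with h | h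
  · rw [if_pos h, if_neg h.not_gt]; ring
  · rw [if_neg h.not_gt, if_pos h]; ring

/-! ### The Koszul complex -/

/-- Adding an element to an index set. -/
def Idx.insert {i : ℕ} (S : Idx l i) (j : {j : Fin l // j ∉ S.1}) : Idx l (i + 1) :=
  ⟨Insert.insert j.1 S.1, by rw [Finset.card_insert_of_notMem j.2, S.2]⟩

/-- The Koszul differential. A chain `f` of degree `i` stands for `∑ f S e_S` over the subsets
`S` of size `i`; the map is `e_T ↦ ∑_{j ∈ T} (-1) ^ #{k ∈ T | k < j} x_j e_{T \ j}`. -/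
def koszulD (x : Fin l → R) (M : Type v) [AddCommGroup M] [Module R M] (i : ℕ) :
    (Idx l (i + 1) → M) →ₗ[R] (Idx l i → M) :=
  LinearMap.pi fun S => ∑ j : {j : Fin l // j ∉ S.1},
    ((sgn S.1 j.1 : R) • x j.1 • LinearMap.proj (R := R) (φ := fun _ : Idx l (i + 1) => M) (S.insert j))

section Koszul

variable (x : Fin l → R) (M : Type v) [AddCommGroup M] [Module R M]

lemma koszulD_apply (i : ℕ) (f : Idx l (i + 1) → M) (S : Idx l i) :
    koszulD x M i f S =
      ∑ j : {j : Fin l // j ∉ S.1}, (sgn S.1 j.1 : R) • x j.1 • f (S.insert j) := by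
  simp [koszulD]

lemma koszulD_comp (i : ℕ) : koszulD x M i ∘ₗ koszulD x M (i + 1) = 0 := by
  refine LinearMap.ext fun f => funext fun S => ?_
  simp only [LinearMap.comp_apply, koszulD_apply, Finset.smul_sum, LinearMap.zero_apply,
    Pi.zero_apply]
  rw [Finset.sum_sigma']
  have key : ∀ a : (Σ j : {j : Fin l // j ∉ S.1}, {k : Fin l // k ∉ (S.insert j).1}),
      a.2.1 ≠ a.1.1 ∧ a.2.1 ∉ S.1 := fun a => by
    have := a.2.2
    simpa [Idx.insert] using this
  refine Finset.sum_involution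
    (fun a _ => ⟨⟨a.2.1, (key a).2⟩, ⟨a.1.1, by
      simp only [Idx.insert, Finset.mem_insert, not_or]
      exact ⟨(key a).1.symm, a.1.2⟩⟩⟩) ?_ ?_ ?_ ?_
  · intro a _
    have e : ((S.insert ⟨a.2.1, (key a).2⟩).insert ⟨a.1.1, by
        simp only [Idx.insert, Finset.mem_insert, not_or]
        exact ⟨(key a).1.symm, a.1.2⟩⟩) = (S.insert a.1).insert a.2 :=
      Subtype.ext (Finset.insert_comm _ _ _)
    have h := sgn_swap S.1 a.1.2 (key a).2 (key a).1.symm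
    rw [e]
    simp only [Idx.insert, smul_smul]
    rw [← add_smul]
    have h' := congrArg (fun z : ℤ => (z : R) * (x a.1.1 * x a.2.1)) h
    push_cast at h'
    convert zero_smul R _
    linear_combination h'
  · intro a _ _ h
    exact (key a).1 (congrArg (fun b => b.1.1) h)
  · intro a _
    simp
  · intro a _
    rfl

/-- The Koszul complex `K_•(x, M)`. -/
def koszul : ChainComplex (ModuleCat.{v} R) ℕ :=
  ChainComplex.of (fun i => ModuleCat.of R (Idx l i → M))
    (fun i => ModuleCat.ofHom (koszulD x M i)) fun i => by
      rw [← ModuleCat.ofHom_comp, koszulD_comp]; rfl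

/-- The degree `i` component of `K_•(x ^ m, M) ⟶ K_•(x ^ n, M)`; on the summand of `e_S` it is
multiplication by `∏_{j ∈ S} x_j ^ (m - n)`. -/
def koszulPowMap (m n i : ℕ) : (Idx l i → M) →ₗ[R] (Idx l i → M) :=
  LinearMap.pi fun S => (∏ j ∈ S.1, x j ^ (m - n)) •
    LinearMap.proj (R := R) (φ := fun _ : Idx l i => M) S

lemma koszulPowMap_comm {m n : ℕ} (h : n ≤ m) (i : ℕ) :
    koszulD (fun j => x j ^ n) M i ∘ₗ koszulPowMap x M m n (i + 1) =
      koszulPowMap x M m n i ∘ₗ koszulD (fun j => x j ^ m) M i := by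
  refine LinearMap.ext fun f => funext fun S => ?_
  simp only [LinearMap.comp_apply, koszulD_apply, koszulPowMap, LinearMap.pi_apply,
    LinearMap.smul_apply, LinearMap.proj_apply, Finset.smul_sum]
  refine Finset.sum_congr rfl fun j _ => ?_
  simp only [Idx.insert, smul_smul, Finset.prod_insert j.2]
  congr 1
  have e : x j.1 ^ n * x j.1 ^ (m - n) = x j.1 ^ m := by rw [← pow_add, Nat.add_sub_cancel' h]
  linear_combination ((sgn S.1 j.1 : R) * ∏ k ∈ S.1, x k ^ (m - n)) * e

/-- The chain map `φ_n^m : K_•(x ^ m, M) ⟶ K_•(x ^ n, M)` for `n ≤ m`. -/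
def koszulTransition {m n : ℕ} (h : n ≤ m) :
    koszul (fun j => x j ^ m) M ⟶ koszul (fun j => x j ^ n) M :=
  ChainComplex.ofHom (fun i => ModuleCat.ofHom (koszulPowMap x M m n i)) fun i => by
    simp only [koszul, ChainComplex.of_d]
    exact congrArg ModuleCat.ofHom (koszulPowMap_comm x M h i)

/-- `x` is `M`-weakly proregular: for each `n` there is `m ≥ n` such that
`H_i(x ^ m, M) ⟶ H_i(x ^ n, M)` is zero for all `i ≥ 1`. -/
def IsWeaklyProregular : Prop :=
  ∀ n : ℕ, ∃ (m : ℕ) (h : n ≤ m), ∀ i : ℕ, 1 ≤ i →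
    HomologicalComplex.homologyMap (koszulTransition x M h) i = 0

end Koszul

/-! ### The Čech complex -/

section Cech

variable (x : Fin l → R) (M : Type v) [AddCommGroup M] [Module R M]

/-- The localization `M_{x_S}`, where `x_S` is the product of the `x_j` with `j ∈ S`. -/
abbrev LocAt (S : Finset (Fin l)) : Type (max u v) :=
  LocalizedModule (Submonoid.powers (∏ j ∈ S, x j)) M

lemma isUnit_locAt {S T : Finset (Fin l)} (h : S ⊆ T)
    (s : Submonoid.powers (∏ j ∈ S, x j)) :
    IsUnit (algebraMap R (Module.End R (LocAt x M T)) s) := by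
  obtain ⟨s, n, rfl⟩ := s
  have hT := IsLocalizedModule.map_units
    (LocalizedModule.mkLinearMap (Submonoid.powers (∏ j ∈ T, x j)) M)
    ⟨∏ j ∈ T, x j, Submonoid.mem_powers _⟩
  have hd : algebraMap R (Module.End R (LocAt x M T)) (∏ j ∈ T, x j) =
      algebraMap R _ (∏ j ∈ S, x j) * algebraMap R _ (∏ j ∈ T \ S, x j) := by
    rw [← map_mul, mul_comm, Finset.prod_sdiff h]
  have hc : Commute (algebraMap R (Module.End R (LocAt x M T)) (∏ j ∈ S, x j))
      (algebraMap R _ (∏ j ∈ T \ S, x j)) := Algebra.commutes _ _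
  rw [hd] at hT
  have := (hc.isUnit_mul_iff.mp hT).1.pow n
  simpa only [map_pow] using this

/-- The localization map `M_{x_S} → M_{x_T}` for `S ⊆ T`. -/
def locMap {S T : Finset (Fin l)} (h : S ⊆ T) : LocAt x M S →ₗ[R] LocAt x M T :=
  LocalizedModule.lift _ (LocalizedModule.mkLinearMap _ M) (isUnit_locAt x M h)

lemma locMap_mk {S T : Finset (Fin l)} (h : S ⊆ T) :
    locMap x M h ∘ₗ LocalizedModule.mkLinearMap _ M = LocalizedModule.mkLinearMap _ M :=
  LocalizedModule.lift_comp _ _ _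

lemma locMap_comp {S T U : Finset (Fin l)} (h : S ⊆ T) (h' : T ⊆ U) :
    locMap x M h' ∘ₗ locMap x M h = locMap x M (h.trans h') := by
  refine IsLocalizedModule.ext (Submonoid.powers (∏ j ∈ S, x j))
    (LocalizedModule.mkLinearMap _ M) (isUnit_locAt x M (h.trans h')) ?_
  rw [LinearMap.comp_assoc, locMap_mk, locMap_mk, locMap_mk]

/-- Removing an element from an index set. -/
def Idx.erase {i : ℕ} (S : Idx l (i + 1)) (j : {j : Fin l // j ∈ S.1}) : Idx l i :=
  ⟨S.1.erase j.1, by rw [Finset.card_erase_of_mem j.2, S.2, Nat.add_sub_cancel]⟩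

lemma Idx.erase_subset {i : ℕ} (S : Idx l (i + 1)) (j : {j : Fin l // j ∈ S.1}) :
    (S.erase j).1 ⊆ S.1 :=
  Finset.erase_subset _ _

/-- The Čech differential `∏_{#S = i} M_{x_S} → ∏_{#S = i + 1} M_{x_S}`, with component at `S`
`∑_{j ∈ S} (-1) ^ #{k ∈ S | k < j} (f (S \ j) viewed in M_{x_S})`. -/
def cechD (i : ℕ) :
    (∀ S : Idx l i, LocAt x M S.1) →ₗ[R] (∀ S : Idx l (i + 1), LocAt x M S.1) :=
  LinearMap.pi fun S => ∑ j : {j : Fin l // j ∈ S.1},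
    (sgn S.1 j.1 : R) • (locMap x M (S.erase_subset j) ∘ₗ
      LinearMap.proj (R := R) (φ := fun S : Idx l i => LocAt x M S.1) (S.erase j))

lemma cechD_apply (i : ℕ) (f : ∀ S : Idx l i, LocAt x M S.1) (S : Idx l (i + 1)) :
    cechD x M i f S = ∑ j : {j : Fin l // j ∈ S.1},
      (sgn S.1 j.1 : R) • locMap x M (S.erase_subset j) (f (S.erase j)) := by
  simp only [cechD, LinearMap.pi_apply, LinearMap.sum_apply]
  rfl

lemma sgn_erase_swap (S : Finset (Fin l)) {j k : Fin l} (hj : j ∈ S) (hk : k ∈ S) (hjk : j ≠ k) :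
    sgn S j * sgn (S.erase j) k + sgn S k * sgn (S.erase k) j = 0 := by
  have h1 := sgn_insert (S.erase j) (Finset.notMem_erase j S) k
  have h2 := sgn_insert (S.erase k) (Finset.notMem_erase k S) j
  rw [Finset.insert_erase hj] at h1
  rw [Finset.insert_erase hk] at h2
  rw [h1, h2]
  rcases lt_or_gt_of_ne hjk with h | h
  · rw [if_pos h, if_neg h.not_gt]; ring
  · rw [if_neg h.not_gt, if_pos h]; ring

lemma locMap_congr {i : ℕ} (f : ∀ S : Idx l i, LocAt x M S.1) {S S' : Idx l i} (e : S = S')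
    {T : Finset (Fin l)} (h : S.1 ⊆ T) (h' : S'.1 ⊆ T) :
    locMap x M h (f S) = locMap x M h' (f S') := by
  subst e; rfl

lemma cechD_comp (i : ℕ) : cechD x M (i + 1) ∘ₗ cechD x M i = 0 := by
  refine LinearMap.ext fun f => funext fun S => ?_
  simp only [LinearMap.comp_apply, cechD_apply, map_sum, map_smul, Finset.smul_sum,
    LinearMap.zero_apply, Pi.zero_apply]
  rw [Finset.sum_sigma']
  have key : ∀ a : (Σ j : {j : Fin l // j ∈ S.1}, {k : Fin l // k ∈ (S.erase j).1}),
      a.2.1 ≠ a.1.1 ∧ a.2.1 ∈ S.1 := fun a =>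
    Finset.mem_erase.mp a.2.2
  refine Finset.sum_involution
    (fun a _ => ⟨⟨a.2.1, (key a).2⟩, ⟨a.1.1, by
      simp only [Idx.erase, Finset.mem_erase]
      exact ⟨(key a).1.symm, a.1.2⟩⟩⟩) ?_ ?_ ?_ ?_
  · intro a _
    have hm : a.1.1 ∈ (S.erase ⟨a.2.1, (key a).2⟩).1 := by
      simp only [Idx.erase, Finset.mem_erase]
      exact ⟨(key a).1.symm, a.1.2⟩
    have e : ((S.erase ⟨a.2.1, (key a).2⟩).erase ⟨a.1.1, hm⟩) = (S.erase a.1).erase a.2 :=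
      Subtype.ext Finset.erase_right_comm
    have h := sgn_erase_swap S.1 a.1.2 (key a).2 (key a).1.symm
    simp only [← LinearMap.comp_apply, locMap_comp, smul_smul]
    rw [locMap_congr x M f e _ (((S.erase a.1).erase_subset a.2).trans (S.erase_subset a.1)),
      ← add_smul]
    simp only [Idx.erase]
    rw [← Int.cast_mul, ← Int.cast_mul, ← Int.cast_add, h, Int.cast_zero, zero_smul]
  · intro a _ _ h
    exact (key a).1 (congrArg (fun b => b.1.1) h)
  · intro a _
    simp
  · intro a _
    rfl

/-- The Čech complex `C(x; M)`. -/
def cech : CochainComplex (ModuleCat.{max u v} R) ℕ :=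
  CochainComplex.of (fun i => ModuleCat.of R (∀ S : Idx l i, LocAt x M S.1))
    (fun i => ModuleCat.ofHom (cechD x M i)) fun i => by
      rw [← ModuleCat.ofHom_comp, cechD_comp]; rfl

end Cech

/-! ### Finite sequences, grades and Cohen-Macaulay modules -/

section Main

variable (M : Type v) [AddCommGroup M] [Module R M]

/-- The Koszul homology `H_i(x, M)`. -/
abbrev koszulHomology (xs : List R) (i : ℕ) : ModuleCat.{v} R :=
  (koszul xs.get M).homology i

/-- The Čech cohomology `H^i_x(M)`. -/
abbrev cechCohomology (xs : List R) (i : ℕ) : ModuleCat.{max u v} R :=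
  (cech xs.get M).homology i

/-- `x` is a parameter sequence on `M`. -/
structure IsParameterSequence (xs : List R) : Prop where
  weaklyProregular : IsWeaklyProregular xs.get M
  smul_ne_top : Ideal.ofList xs • (⊤ : Submodule R M) ≠ ⊤
  cech_nontrivial : ∀ p : PrimeSpectrum R,
    p ∈ Module.support R (M ⧸ (Ideal.ofList xs • (⊤ : Submodule R M))) →
      Nontrivial (LocalizedModule p.asIdeal.primeCompl (cechCohomology M xs xs.length))

/-- `x = x_1, …, x_l` is a strong parameter sequence on `M`: each `x_1, …, x_i` with
`1 ≤ i ≤ l` is a parameter sequence. The empty sequence always is one. -/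
def IsStrongParameterSequence (xs : List R) : Prop :=
  ∀ i : ℕ, 1 ≤ i → i ≤ xs.length → IsParameterSequence M (xs.take i)

/-- `M`-regular sequences; the empty sequence counts as regular on every module. -/
def IsRegularSequence (xs : List R) : Prop :=
  xs = [] ∨ RingTheory.Sequence.IsRegular M xs

variable (R) in
/-- `M` is Cohen-Macaulay: every strong parameter sequence on `M` is `M`-regular. -/
def IsCohenMacaulay : Prop :=
  ∀ xs : List R, IsStrongParameterSequence M xs → IsRegularSequence M xs

/-- The classical grade: the supremum of the lengths of the weak `M`-regular sequences
contained in `I`. -/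
def classicalGrade (I : Ideal R) : ℕ∞ :=
  ⨆ (xs : List R) (_ : (∀ r ∈ xs, r ∈ I) ∧ RingTheory.Sequence.IsWeaklyRegular M xs),
    (xs.length : ℕ∞)

/-- The polynomial grade of `I` on `M` is `g`: as `m → ∞`, the classical grade of
`I R[t_1, …, t_m]` on `R[t_1, …, t_m] ⊗ M` tends to `g`. -/
def HasPolynomialGrade (I : Ideal R) (g : ℕ∞) : Prop :=
  Tendsto (fun m : ℕ => classicalGrade (R := MvPolynomial (Fin m) R) (MvPolynomial (Fin m) R ⊗[R] M)
    (I.map (algebraMap R (MvPolynomial (Fin m) R)))) atTop (𝓝 g)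

end Main

end NonNoethCM

end

namespace NonNoethCM

universe u v

/-! ### Signs and extension of cochains by zero -/

section SignsAndExtensions

variable {l : ℕ}

/-! Two properties of strong parameter sequences carry the argument: initial segments are again
strong parameter sequences, and `xM ≠ M`. The implications proved are 1 → 2 → 3 → 4 → 1 and 1 ↔ 5.

Koszul side. The ideal `(x)` kills Koszul homology, so a weakly regular sequence of length `k` in
`(x)` makes the top `k` homology modules vanish (`koszulExact_of_isWeaklyRegular`). With `k > ℓ`
this would give `H_0 = M/xM = 0`, so the grade is at most `ℓ`; a regular `x` attains it, and
faithfully flat extension to polynomial rings preserves the equality. Conversely, polynomial grade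
`ℓ` provides `ℓ` weakly regular elements over some `R[t_1, …, t_m]`; hence all `H_i` with `i ≥ 1`
vanish there, and also over `R` through the retraction `t ↦ 0`. Finally, `H_1 = 0` for each initial
segment says that its last element is regular modulo the preceding ones
(`KoszulExact.mem_of_smul_mem`).

Čech side. Each `x_j` acts locally nilpotently on Čech cohomology, whereas the long exact sequence
of `0 → M → M → M/yM → 0` makes a regular `y` act injectively in low degrees; together these give
vanishing. Conversely, vanishing descends from `M` to `M/yM` with the loss of one degree, until `H^0
= 0` says that no nonzero element is killed by all of `x`. -/

lemma sgn_mul_self (S : Finset (Fin l)) (j : Fin l) : sgn S j * sgn S j = 1 := by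
  unfold sgn
  rw [← pow_add, ← two_mul, pow_mul]
  simp

lemma sgn_insert_self (S : Finset (Fin l)) (j : Fin l) : sgn (insert j S) j = sgn S j := by
  unfold sgn
  rw [Finset.filter_insert, if_neg (lt_irrefl j)]

lemma sgn_erase_self (S : Finset (Fin l)) (j : Fin l) : sgn (S.erase j) j = sgn S j := by
  rw [← sgn_insert_self (S.erase j) j]
  by_cases hj : j ∈ S
  · rw [Finset.insert_erase hj]
  · rw [Finset.erase_eq_of_notMem hj, sgn_insert_self]

/-- Extension by zero of a family indexed by the subsets of size `i` to all subsets. -/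
def extendZero {A : Finset (Fin l) → Type*} [∀ S, Zero (A S)] {i : ℕ}
    (f : ∀ S : Idx l i, A S.1) (S : Finset (Fin l)) : A S :=
  if h : S.card = i then f ⟨S, h⟩ else 0

lemma extendZero_coe {A : Finset (Fin l) → Type*} [∀ S, Zero (A S)] {i : ℕ}
    (f : ∀ S : Idx l i, A S.1) (S : Idx l i) : extendZero f S.1 = f S := by
  simp [extendZero, S.2]

lemma extendZero_of_card {A : Finset (Fin l) → Type*} [∀ S, Zero (A S)] {i : ℕ}
    (f : ∀ S : Idx l i, A S.1) {S : Finset (Fin l)} (h : S.card = i) :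
    extendZero f S = f ⟨S, h⟩ := by
  simp [extendZero, h]

end SignsAndExtensions

/-! ### Koszul homology, weakly regular sequences and grade -/

section Koszul

variable {R : Type u} [CommRing R] {l : ℕ} (x : Fin l → R)
variable (M : Type v) [AddCommGroup M] [Module R M]

lemma koszulD_apply_eq_sum (i : ℕ) (f : Idx l (i + 1) → M) (S : Idx l i) :
    koszulD x M i f S =
      ∑ j ∈ S.1ᶜ, (sgn S.1 j : R) • x j • extendZero (A := fun _ => M) f (insert j S.1) := by
  rw [koszulD_apply, Finset.sum_subtype (p := fun j => j ∉ S.1) S.1ᶜ (by simp)]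
  refine Finset.sum_congr rfl fun j _ => ?_
  rw [← extendZero_coe (A := fun _ => M) f (S.insert j)]
  rfl

/-- `f` is a cycle of the Koszul complex. -/
def IsKoszulCycle : (i : ℕ) → (Idx l i → M) → Prop
  | 0, _ => True
  | i + 1, f => koszulD x M i f = 0

/-- Every cycle of degree `i` of the Koszul complex is a boundary. -/
def KoszulExact (i : ℕ) : Prop :=
  ∀ f : Idx l i → M, IsKoszulCycle x M i f → ∃ g, koszulD x M i g = f

lemma isZero_koszul_homology_iff (i : ℕ) :
    Limits.IsZero ((koszul x M).homology (i + 1)) ↔ KoszulExact x M (i + 1) := by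
  rw [← HomologicalComplex.exactAt_iff_isZero_homology,
    HomologicalComplex.exactAt_iff' _ (i + 1 + 1) (i + 1) i (by simp) (by simp),
    ShortComplex.moduleCat_exact_iff]
  simp only [HomologicalComplex.sc', HomologicalComplex.shortComplexFunctor', koszul,
    ChainComplex.of_d]
  rfl

/-- Contraction of the Koszul complex with the `j`-th basis vector. -/
def koszulContract (j : Fin l) {i : ℕ} (f : Idx l i → M) : Idx l (i + 1) → M := fun T =>
  if j ∈ T.1 then (sgn T.1 j : R) • extendZero (A := fun _ => M) f (T.1.erase j) else 0

variable {M}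

/-- Left multiplication by `e_j` is a homotopy between multiplication by `x_j` and zero; on a cycle
only one of the two homotopy terms remains. -/
lemma koszulD_koszulContract (j : Fin l) {i : ℕ} (f : Idx l i → M) (hf : IsKoszulCycle x M i f) :
    koszulD x M i (koszulContract (R := R) M j f) = x j • f := by
  ext S
  rw [koszulD_apply_eq_sum, Pi.smul_apply]
  have hins : ∀ k ∈ S.1ᶜ, extendZero (A := fun _ => M) (koszulContract (R := R) M j f)
      (insert k S.1) = if j ∈ insert k S.1 then (sgn (insert k S.1) j : R) •
        extendZero (A := fun _ => M) f ((insert k S.1).erase j) else 0 := fun k hk => by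
    rw [extendZero_of_card _ (by
      rw [Finset.card_insert_of_notMem (Finset.mem_compl.mp hk), S.2])]
    rfl
  by_cases hj : j ∈ S.1
  · obtain _ | i := i
    · have := Finset.card_eq_zero.mp S.2
      simp [this] at hj
    -- The cycle condition at `S \ j` expresses `x_j f(S)` through the terms with `k ∉ S`.
    have hc := congrFun hf ⟨S.1.erase j, by rw [Finset.card_erase_of_mem hj, S.2]; rfl⟩
    rw [koszulD_apply_eq_sum, Finset.compl_erase,
      Finset.sum_insert (by simpa using hj), Finset.insert_erase hj,
      extendZero_coe, Pi.zero_apply] at hc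
    have hc' := congrArg (fun z => (sgn (S.1.erase j) j : R) • z) hc
    simp only [smul_add, smul_zero, Finset.smul_sum] at hc'
    rw [smul_smul, ← Int.cast_mul, sgn_mul_self, Int.cast_one, one_smul] at hc'
    rw [eq_neg_of_add_eq_zero_left hc', ← Finset.sum_neg_distrib]
    refine Finset.sum_congr rfl fun k hk => ?_
    have hkS : k ∉ S.1 := Finset.mem_compl.mp hk
    have hkj : k ≠ j := fun h => hkS (h ▸ hj)
    rw [hins k hk, if_pos (Finset.mem_insert_of_mem hj),
      Finset.erase_insert_of_ne hkj]
    have h := sgn_swap (S.1.erase j) (Finset.notMem_erase j _)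
      (fun h => hkS (Finset.mem_of_mem_erase h)) hkj.symm
    rw [Finset.insert_erase hj, ← Finset.erase_insert_of_ne hkj, Finset.erase_insert_of_ne hkj] at h
    have h2 : sgn (insert k (S.1.erase j)) j = sgn (insert k S.1) j := by
      rw [← Finset.erase_insert_of_ne hkj, sgn_erase_self]
    rw [h2] at h
    have h3 : sgn S.1 k * sgn (insert k S.1) j =
        - (sgn (S.1.erase j) j * sgn (S.1.erase j) k) := by
      have a := sgn_mul_self (S.1.erase j) j
      have b := sgn_mul_self (S.1.erase j) k
      linear_combination (sgn (S.1.erase j) j * sgn (insert k S.1) j) * h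
        - sgn S.1 k * sgn (insert k S.1) j * a
        - sgn (S.1.erase j) j * sgn (S.1.erase j) k * sgn_mul_self (insert k S.1) j
    have h4 := congrArg (fun z : ℤ => (z : R) * x k) h3
    push_cast at h4
    simp only [smul_smul, ← neg_smul]
    congr 1
    linear_combination h4
  · rw [Finset.sum_eq_single j]
    · rw [hins j (by simpa using hj), if_pos (Finset.mem_insert_self _ _),
        Finset.erase_insert hj, extendZero_coe, sgn_insert_self, smul_comm (x j), smul_smul,
        ← Int.cast_mul, sgn_mul_self, Int.cast_one, one_smul]
    · intro k hk hkj
      rw [hins k hk, if_neg (by simp [hj, hkj.symm])]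
      simp
    · intro h
      simp [hj] at h

/-- The ideal generated by `x` annihilates Koszul homology. -/
lemma exists_koszulD_eq_smul {y : R} (hy : y ∈ Ideal.span (Set.range x)) {i : ℕ}
    (f : Idx l i → M) (hf : IsKoszulCycle x M i f) : ∃ g, koszulD x M i g = y • f := by
  change y • f ∈ LinearMap.range (koszulD x M i)
  induction hy using Submodule.span_induction with
  | mem y h =>
    obtain ⟨j, rfl⟩ := h
    exact ⟨_, koszulD_koszulContract x j f hf⟩
  | zero => rw [zero_smul]; exact zero_mem _
  | add a b _ _ ha hb => rw [add_smul]; exact add_mem ha hb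
  | smul a b _ hb => rw [smul_assoc]; exact Submodule.smul_mem _ _ hb

lemma koszulD_map {N : Type*} [AddCommGroup N] [Module R N] (φ : M →ₗ[R] N) {i : ℕ}
    (f : Idx l (i + 1) → M) :
    koszulD x N i (fun S => φ (f S)) = fun S => φ (koszulD x M i f S) := by
  ext S
  simp [koszulD_apply, map_sum]

lemma exists_smul_of_mk_eq_zero {y : R} {m : M} (h : (Submodule.Quotient.mk m : QuotSMulTop y M) = 0) :
    ∃ n, y • n = m := by
  rw [Submodule.Quotient.mk_eq_zero, Submodule.mem_smul_pointwise_iff_exists] at h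
  obtain ⟨n, -, h⟩ := h
  exact ⟨n, h⟩

lemma mk_smul_eq_zero (y : R) (m : M) : (Submodule.Quotient.mk (y • m) : QuotSMulTop y M) = 0 :=
  (Submodule.Quotient.mk_eq_zero _).mpr (Submodule.smul_mem_pointwise_smul _ _ _ trivial)

/-- A weakly regular sequence of length `k` in the ideal generated by `x` makes the `k` top
Koszul homology modules vanish. -/
lemma koszulExact_of_isWeaklyRegular (ys : List R) :
    ∀ {M : Type v} [AddCommGroup M] [Module R M],
      RingTheory.Sequence.IsWeaklyRegular M ys → (∀ y ∈ ys, y ∈ Ideal.span (Set.range x)) →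
      ∀ i, l < i + ys.length → KoszulExact x M i := by
  induction ys with
  | nil =>
    intro M _ _ _ _ i hi f _
    have : IsEmpty (Idx l i) := ⟨fun S => by
      have := S.1.card_le_univ
      rw [S.2, Fintype.card_fin] at this
      simp at hi
      omega⟩
    exact ⟨0, Subsingleton.elim _ _⟩
  | cons y ys ih =>
    intro M _ _ hreg hmem i hi f hf
    rw [RingTheory.Sequence.isWeaklyRegular_cons_iff] at hreg
    -- Since `y` kills homology, `y f = dg`, so `g` is a cycle modulo `y` in degree `i + 1`. There
    -- `i + 1` plus the length of the tail still exceeds `l`, and the induction hypothesis applies.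
    obtain ⟨g, hg⟩ := exists_koszulD_eq_smul x (hmem y (by simp)) f hf
    let π : M →ₗ[R] QuotSMulTop y M := Submodule.mkQ _
    have hcyc : IsKoszulCycle x (QuotSMulTop y M) (i + 1) (fun S => π (g S)) := by
      change koszulD _ _ _ _ = 0
      rw [koszulD_map, hg]
      ext S
      exact mk_smul_eq_zero y (f S)
    obtain ⟨h', hh'⟩ := ih hreg.2 (fun z hz => hmem z (by simp [hz])) (i + 1)
      (by simp at hi; omega) _ hcyc
    choose h hh using fun S => Submodule.mkQ_surjective _ (h' S)
    have hdiff : ∀ S, ∃ n, y • n = g S - koszulD x M (i + 1) h S := fun S => by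
      refine exists_smul_of_mk_eq_zero ?_
      have h1 := congrFun (koszulD_map x π h) S
      have h2 : (fun S => π (h S)) = h' := funext hh
      rw [h2, hh'] at h1
      change π _ = 0
      rw [map_sub, ← h1, sub_self]
    -- Now `g - dh = y g'`, whence `y dg' = y f`, and `y` cancels.
    choose g' hg' using hdiff
    refine ⟨g', ?_⟩
    have e : y • g' = g - koszulD x M (i + 1) h := funext hg'
    have e' := congrArg (koszulD x M i) e
    rw [map_sub, map_smul, hg, ← LinearMap.comp_apply, koszulD_comp, LinearMap.zero_apply,
      sub_zero] at e'
    exact funext fun S => hreg.1 (congrFun e' S)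

/-- A longer weakly regular sequence would force exactness in degree `0` as well, that is, `M = xM`.
-/
lemma classicalGrade_le (h : Ideal.span (Set.range x) • (⊤ : Submodule R M) ≠ ⊤) :
    classicalGrade M (Ideal.span (Set.range x)) ≤ l := by
  refine iSup₂_le fun ys ⟨hmem, hreg⟩ => ?_
  by_contra! hlt
  refine h (eq_top_iff.mpr fun m _ => ?_)
  obtain ⟨g, hg⟩ := koszulExact_of_isWeaklyRegular x ys hreg hmem 0
    (by simpa using hlt) (fun _ => m) trivial
  rw [← congrFun hg ⟨∅, rfl⟩, koszulD_apply]
  refine Submodule.sum_mem _ fun j _ => Submodule.smul_mem _ _ ?_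
  exact Submodule.smul_mem_smul (Ideal.subset_span ⟨_, rfl⟩) trivial

lemma exists_isWeaklyRegular_of_le_classicalGrade {I : Ideal R} {n : ℕ}
    (h : (n : ℕ∞) ≤ classicalGrade M I) :
    ∃ ys : List R, (∀ y ∈ ys, y ∈ I) ∧ RingTheory.Sequence.IsWeaklyRegular M ys ∧
      n ≤ ys.length := by
  obtain _ | n := n
  · exact ⟨[], by simp, by simp, by simp⟩
  have h' : (n : ℕ∞) < classicalGrade M I := lt_of_lt_of_le (by exact_mod_cast n.lt_succ_self) h
  simp only [classicalGrade, lt_iSup_iff] at h'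
  obtain ⟨ys, ⟨h1, h2⟩, h3⟩ := h'
  exact ⟨ys, h1, h2, by exact_mod_cast h3⟩

lemma le_classicalGrade {I : Ideal R} {ys : List R} (h : ∀ y ∈ ys, y ∈ I)
    (hr : RingTheory.Sequence.IsWeaklyRegular M ys) :
    (ys.length : ℕ∞) ≤ classicalGrade M I :=
  le_iSup₂ (f := fun (ys : List R) (_ : (∀ r ∈ ys, r ∈ I) ∧
    RingTheory.Sequence.IsWeaklyRegular M ys) => (ys.length : ℕ∞)) ys ⟨h, hr⟩

/-- If `H_1(x, M) = 0` then `x_a` is a non-zero-divisor modulo the submodule generated by the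
multiples of the remaining elements. -/
lemma KoszulExact.mem_of_smul_mem (h : KoszulExact x M 1) (a : Fin l) {m : M}
    (hm : x a • m ∈ Ideal.span (x '' {j | j ≠ a}) • (⊤ : Submodule R M)) :
    m ∈ Ideal.span (x '' {j | j ≠ a}) • (⊤ : Submodule R M) := by
  have hsum : ∃ n : Fin l → M, x a • m = ∑ j ∈ {a}ᶜ, x j • n j := by
    let φ : (Fin l → M) →ₗ[R] M := ∑ j ∈ {a}ᶜ, x j • LinearMap.proj j
    have key : Ideal.span (x '' {j | j ≠ a}) • (⊤ : Submodule R M) ≤ LinearMap.range φ := by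
      refine Submodule.smul_le.mpr fun r hr z _ => ?_
      induction hr using Submodule.span_induction with
      | mem r hr =>
        obtain ⟨j, hj, rfl⟩ := hr
        refine ⟨Pi.single j z, ?_⟩
        simp only [φ, LinearMap.sum_apply, LinearMap.smul_apply, LinearMap.proj_apply]
        rw [Finset.sum_eq_single j]
        · simp
        · intro k _ hk
          simp [Pi.single_eq_of_ne hk]
        · intro hj'
          simp at hj'
          exact absurd hj' hj
      | zero => simp
      | add r s _ _ hr hs => rw [add_smul]; exact add_mem hr hs
      | smul r s _ hs => rw [smul_assoc]; exact Submodule.smul_mem _ _ hs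
    obtain ⟨n, hn⟩ := key hm
    exact ⟨n, by rw [← hn]; simp [φ]⟩
  obtain ⟨n, hn⟩ := hsum
  -- The chain `m e_a - ∑ n_j e_j` is a cycle because `x_a m = ∑ x_j n_j`. In a boundary, the
  -- coefficient of `e_a` involves only the `x_j` with `j ≠ a`.
  let F : Finset (Fin l) → M := fun S => if a ∈ S then m else - ∑ j ∈ S, n j
  obtain ⟨g, hg⟩ := h (fun S => F S.1) (by
    change koszulD _ _ _ _ = 0
    ext S
    have hS : S.1 = ∅ := Finset.card_eq_zero.mp S.2
    rw [koszulD_apply_eq_sum, hS]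
    have hF : ∀ j : Fin l, extendZero (A := fun _ => M) (i := 1)
        (fun S => F S.1) (insert j ∅) = F {j} := fun j => extendZero_of_card _ (by simp)
    rw [Finset.sum_congr rfl fun j _ => by rw [hF j]]
    rw [Finset.compl_empty, ← Finset.sum_add_sum_compl {a}, Finset.sum_singleton]
    simp only [sgn, Finset.filter_empty, Finset.card_empty, pow_zero, Int.cast_one, one_smul]
    rw [Finset.sum_congr (g := fun j => - (x j • n j)) rfl fun j hj => by
      have : a ≠ j := fun h => by simp [h] at hj
      simp [F, this]]
    simp [F, hn])
  have hg' := congrFun hg ⟨{a}, by simp⟩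
  have : F {a} = m := by simp [F]
  rw [this, koszulD_apply_eq_sum] at hg'
  rw [← hg']
  refine Submodule.sum_mem _ fun j hj => Submodule.smul_mem _ _ ?_
  exact Submodule.smul_mem_smul (Ideal.subset_span ⟨j, by simpa using hj, rfl⟩) trivial

end Koszul

/-! ### Descent of Koszul exactness -/

section BaseChange

variable {R : Type u} [CommRing R] {l : ℕ} (x : Fin l → R)
variable {M : Type v} [AddCommGroup M] [Module R M]

/-- Koszul exactness descends along a base change to an algebra with a retraction. -/
lemma KoszulExact.of_baseChange {A : Type*} [CommRing A] [Algebra R A] (ρ : A →ₗ[R] R)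
    (hρ : ρ 1 = 1) {i : ℕ} (h : KoszulExact (fun j => algebraMap R A (x j)) (A ⊗[R] M) i) :
    KoszulExact x M i := by
  let ι : M →ₗ[R] A ⊗[R] M := TensorProduct.mk R A M 1
  let π : A ⊗[R] M →ₗ[R] M := TensorProduct.lid R M ∘ₗ ρ.rTensor M
  have hπ : ∀ m, π (ι m) = m := fun m => by simp [π, ι, hρ]
  -- The Koszul complex over `A` is that of the `R`-module `A ⊗ M`, so the `R`-linear maps `ι` and
  -- `π` commute with the differentials.
  have hd : ∀ (i : ℕ) (f : Idx l (i + 1) → A ⊗[R] M),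
      koszulD (fun j => algebraMap R A (x j)) (A ⊗[R] M) i f = koszulD x (A ⊗[R] M) i f := by
    intro i f
    ext S
    simp only [koszulD_apply]
    refine Finset.sum_congr rfl fun j _ => ?_
    rw [algebraMap_smul, Int.cast_smul_eq_zsmul, Int.cast_smul_eq_zsmul]
  intro f hf
  obtain ⟨g, hg⟩ := h (fun S => ι (f S)) (by
    obtain _ | i := i
    · trivial
    · change koszulD _ _ _ _ = 0
      rw [hd, koszulD_map, show koszulD x M i f = 0 from hf]
      ext S
      simp)
  refine ⟨fun S => π (g S), ?_⟩
  rw [koszulD_map, ← hd, hg]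
  ext S
  exact hπ _

end BaseChange

/-! ### Čech cohomology and local nilpotence -/

section Cech

variable {R : Type u} [CommRing R] {l : ℕ} (x : Fin l → R)
variable (M : Type v) [AddCommGroup M] [Module R M]

lemma cechD_apply_eq_sum (i : ℕ) (f : ∀ S : Idx l i, LocAt x M S.1) (S : Idx l (i + 1)) :
    cechD x M i f S = ∑ j ∈ S.1, (sgn S.1 j : R) • locMap x M (Finset.erase_subset j S.1)
      (extendZero (A := LocAt x M) f (S.1.erase j)) := by
  rw [cechD_apply, Finset.sum_subtype (p := fun j => j ∈ S.1) S.1 (by simp)]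
  refine Finset.sum_congr rfl fun j _ => ?_
  rw [← extendZero_coe (A := LocAt x M) f (S.erase j)]
  rfl

/-- `f` is a boundary of the Čech complex. -/
def IsCechBoundary : (i : ℕ) → (∀ S : Idx l i, LocAt x M S.1) → Prop
  | 0, f => f = 0
  | i + 1, f => ∃ g, cechD x M i g = f

/-- Every cocycle of degree `i` of the Čech complex is a coboundary. -/
def CechExact (i : ℕ) : Prop :=
  ∀ f, cechD x M i f = 0 → IsCechBoundary x M i f

lemma isZero_cech_homology_iff (i : ℕ) :
    Limits.IsZero ((cech x M).homology i) ↔ CechExact x M i := by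
  rw [← HomologicalComplex.exactAt_iff_isZero_homology]
  obtain _ | i := i
  -- In degree `0` the predecessor index is `0` itself, and the incoming map `d 0 0` is zero.
  · rw [HomologicalComplex.exactAt_iff' _ 0 0 1 (by simp) (by simp),
      ShortComplex.moduleCat_exact_iff]
    have h0 : (cech x M).d 0 0 = 0 := (cech x M).shape 0 0 (by simp)
    simp only [HomologicalComplex.sc', HomologicalComplex.shortComplexFunctor', h0]
    simp only [cech]
    refine forall_congr' fun f => imp_congr_right fun _ => ?_
    exact ⟨fun ⟨_, h⟩ => h.symm, fun h => ⟨0, h.symm⟩⟩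
  · rw [HomologicalComplex.exactAt_iff' _ i (i + 1) (i + 1 + 1) (by simp) (by simp),
      ShortComplex.moduleCat_exact_iff]
    simp only [HomologicalComplex.sc', HomologicalComplex.shortComplexFunctor', cech,
      CochainComplex.of_d]
    rfl

variable {M}

lemma smul_locAt_injective {S T : Finset (Fin l)} (h : S ⊆ T) (n : ℕ) {z w : LocAt x M T}
    (e : (∏ j ∈ S, x j) ^ n • z = (∏ j ∈ S, x j) ^ n • w) : z = w := by
  have := isUnit_locAt x M h ⟨(∏ j ∈ S, x j) ^ n, n, rfl⟩
  rw [Module.End.isUnit_iff] at this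
  exact this.1 e

lemma exists_smul_eq_mk (S : Finset (Fin l)) (z : LocAt x M S) :
    ∃ (n : ℕ) (m : M), (∏ j ∈ S, x j) ^ n • z = LocalizedModule.mkLinearMap _ M m := by
  obtain ⟨⟨m, s, n, rfl⟩, h⟩ := IsLocalizedModule.surj
    (Submonoid.powers (∏ j ∈ S, x j)) (LocalizedModule.mkLinearMap _ M) z
  exact ⟨n, m, h⟩

lemma locMap_mkLinearMap {S T : Finset (Fin l)} (h : S ⊆ T) (m : M) :
    locMap x M h (LocalizedModule.mkLinearMap _ M m) = LocalizedModule.mkLinearMap _ M m :=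
  LinearMap.congr_fun (locMap_mk x M h) m

lemma locMap_locMap {S T U : Finset (Fin l)} (h : S ⊆ T) (h' : T ⊆ U) (z : LocAt x M S) :
    locMap x M h' (locMap x M h z) = locMap x M (h.trans h') z :=
  LinearMap.congr_fun (locMap_comp x M h h') z

lemma locMap_self {S : Finset (Fin l)} (z : LocAt x M S) :
    locMap x M (Finset.Subset.refl S) z = z := by
  obtain ⟨n, m, h⟩ := exists_smul_eq_mk x S z
  refine smul_locAt_injective x subset_rfl n ?_
  rw [← map_smul, h, locMap_mkLinearMap]

/-- The kernel of `M_{x_S} → M_{x_S x_j}` is `x_j`-power torsion. -/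
lemma exists_pow_smul_eq_zero {S : Finset (Fin l)} {j : Fin l} (z : LocAt x M S)
    (hz : locMap x M (Finset.subset_insert j S) z = 0) : ∃ n : ℕ, x j ^ n • z = 0 := by
  by_cases hj : j ∈ S
  · refine ⟨0, ?_⟩
    have : ∀ T (h : S ⊆ T), T = S → locMap x M h z = 0 → z = 0 := by
      rintro T h rfl h0
      rwa [locMap_self] at h0
    rw [this _ _ (Finset.insert_eq_of_mem hj) hz, smul_zero]
  obtain ⟨n, m, h⟩ := exists_smul_eq_mk x S z
  have h0 : LocalizedModule.mkLinearMap (Submonoid.powers (∏ k ∈ insert j S, x k)) M m = 0 := by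
    rw [← locMap_mkLinearMap x (Finset.subset_insert j S), ← h, map_smul, hz, smul_zero]
  rw [IsLocalizedModule.eq_zero_iff (Submonoid.powers (∏ k ∈ insert j S, x k))] at h0
  obtain ⟨⟨_, N, rfl⟩, hN⟩ := h0
  refine ⟨N, smul_locAt_injective x subset_rfl (N + n) ?_⟩
  have hN' : (∏ k ∈ insert j S, x k) ^ N • m = 0 := hN
  rw [Finset.prod_insert hj, mul_pow] at hN'
  rw [smul_zero, pow_add, mul_smul, smul_comm _ (x j ^ N), h, ← map_smul, ← map_smul,
    smul_comm, smul_smul, hN', map_zero]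

/-- Up to a power of `x_j`, elements of `M_{x_S x_j}` come from `M_{x_S}`. -/
lemma exists_locMap_eq_pow_smul {S : Finset (Fin l)} {j : Fin l} (w : LocAt x M (insert j S)) :
    ∃ n : ℕ, ∃ z : LocAt x M S, locMap x M (Finset.subset_insert j S) z = x j ^ n • w := by
  by_cases hj : j ∈ S
  · refine ⟨0, ?_⟩
    have : ∀ T (h : S ⊆ T) (w : LocAt x M T), T = S → ∃ z, locMap x M h z = w := by
      rintro T h v rfl
      exact ⟨v, locMap_self x v⟩
    obtain ⟨z, hz⟩ := this _ (Finset.subset_insert j S) w (Finset.insert_eq_of_mem hj)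
    exact ⟨z, by rw [hz, pow_zero, one_smul]⟩
  obtain ⟨n, m, h⟩ := exists_smul_eq_mk x _ w
  let s : Submonoid.powers (∏ k ∈ S, x k) := ⟨_, n, rfl⟩
  refine ⟨n, LocalizedModule.mk m s, smul_locAt_injective x (Finset.subset_insert j S) n ?_⟩
  have e : (∏ k ∈ S, x k) ^ n • (LocalizedModule.mk m s : LocAt x M S) =
      LocalizedModule.mkLinearMap _ M m := by
    change (s : R) • _ = _
    rw [LocalizedModule.smul'_mk, LocalizedModule.mkLinearMap_apply]
    exact LocalizedModule.mk_cancel s m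
  rw [← map_smul, e, locMap_mkLinearMap, ← h, smul_smul, ← mul_pow, mul_comm, ← Finset.prod_insert hj]

lemma pow_smul_eq_zero_of_le {N : Type*} [AddCommGroup N] [Module R N] {r : R} {n n' : ℕ}
    (h : n ≤ n') {z : N} (hz : r ^ n • z = 0) : r ^ n' • z = 0 := by
  rw [← Nat.sub_add_cancel h, pow_add, mul_smul, hz, smul_zero]

/-- There are finitely many index sets, so the largest exponent serves for all of them. -/
lemma exists_uniform_pow_smul_eq_zero (j : Fin l) {i : ℕ} (f : ∀ S : Idx l i, LocAt x M S.1)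
    (hf : ∀ S : Idx l i, locMap x M (Finset.subset_insert j S.1) (f S) = 0) : ∃ n : ℕ, x j ^ n • f = 0 := by
  choose n hn using fun S => exists_pow_smul_eq_zero x (f S) (hf S)
  refine ⟨Finset.univ.sup n, funext fun S => ?_⟩
  have h : x j ^ Finset.univ.sup n • f S = 0 :=
    pow_smul_eq_zero_of_le (Finset.le_sup (Finset.mem_univ S)) (hn S)
  exact h

lemma exists_uniform_locMap_eq_pow_smul (j : Fin l) (w : ∀ S, LocAt x M S) :
    ∃ (n : ℕ) (z : ∀ S, LocAt x M S), ∀ S,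
      locMap x M (Finset.subset_insert j S) (z S) = x j ^ n • w (insert j S) := by
  choose n z hz using fun S => exists_locMap_eq_pow_smul x (w (insert j S))
  refine ⟨Finset.univ.sup n, fun S => x j ^ (Finset.univ.sup n - n S) • z S, fun S => ?_⟩
  rw [map_smul, hz, smul_smul, ← pow_add, Nat.sub_add_cancel (Finset.le_sup (Finset.mem_univ S))]

lemma IsCechBoundary.smul {i : ℕ} {f : ∀ S : Idx l i, LocAt x M S.1}
    (h : IsCechBoundary x M i f) (r : R) : IsCechBoundary x M i (r • f) := by
  obtain _ | i := i
  · rw [show f = 0 from h, smul_zero]; rfl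
  · obtain ⟨g, rfl⟩ := h
    exact ⟨r • g, map_smul _ _ _⟩

lemma locMap_extendZero_congr {i : ℕ} (f : ∀ S : Idx l i, LocAt x M S.1) {S S' T : Finset (Fin l)}
    (e : S = S') (h : S ⊆ T) (h' : S' ⊆ T) :
    locMap x M h (extendZero (A := LocAt x M) f S) =
      locMap x M h' (extendZero (A := LocAt x M) f S') := by
  subst e; rfl

/-- Each `x_j` acts locally nilpotently on Čech cohomology. -/
lemma exists_isCechBoundary_pow_smul (j : Fin l) {i : ℕ} (f : ∀ S : Idx l i, LocAt x M S.1)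
    (hf : cechD x M i f = 0) : ∃ n : ℕ, IsCechBoundary x M i (x j ^ n • f) := by
  obtain _ | i := i
  · refine exists_uniform_pow_smul_eq_zero x j f fun S => ?_
    have hS : S = ⟨∅, rfl⟩ := Subtype.ext (Finset.card_eq_zero.mp S.2)
    subst hS
    have h := congrFun hf ⟨insert j ∅, by simp⟩
    rw [cechD_apply_eq_sum, Finset.sum_insert (Finset.notMem_empty j), Finset.sum_empty, add_zero,
      locMap_extendZero_congr x f (Finset.erase_insert (Finset.notMem_empty j)) _
        (Finset.subset_insert j ∅)] at h
    have h' := congrArg (fun z => (sgn (insert j ∅) j : R) • z) h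
    simp only [Pi.zero_apply, smul_zero] at h'
    rw [smul_smul, ← Int.cast_mul, sgn_mul_self, Int.cast_one, one_smul,
      extendZero_of_card f rfl] at h'
    exact h'
  let F := extendZero (A := LocAt x M) f
  obtain ⟨n, z, hz⟩ := exists_uniform_locMap_eq_pow_smul x j F
  -- After inverting `x_j`, the assignment `S ↦ ± f(S ∪ j)` for `j ∉ S` is a contracting homotopy.
  -- `G` is this homotopy with the denominators cleared by `x_j ^ n`.
  let G : ∀ S, LocAt x M S := fun S => if j ∈ S then 0 else (sgn S j : R) • z S
  let g : ∀ S : Idx l i, LocAt x M S.1 := fun S => G S.1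
  have hg : ∀ T : Idx l (i + 1), ∀ k ∈ T.1, extendZero (A := LocAt x M) g (T.1.erase k) =
      G (T.1.erase k) := fun T k hk =>
    extendZero_of_card g (by rw [Finset.card_erase_of_mem hk, T.2]; rfl)
  have hzT : ∀ {S T U : Finset (Fin l)} (h : S ⊆ T) (h' : U ⊆ T), U = insert j S →
      locMap x M h (z S) = x j ^ n • locMap x M h' (F U) := by
    rintro S T U h h' rfl
    rw [← locMap_locMap x (Finset.subset_insert j S) h', hz, map_smul]
  -- Consequently `dg` and `x_j ^ n f` agree once `x_j` is inverted, and a further power of `x_j`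
  -- kills their difference.
  obtain ⟨n', hn'⟩ := exists_uniform_pow_smul_eq_zero x j
    (cechD x M i g - x j ^ n • f) fun T => by
      rw [Pi.sub_apply, Pi.smul_apply, cechD_apply_eq_sum]
      by_cases hj : j ∈ T.1
      · rw [Finset.sum_eq_single j, hg T j hj]
        · simp only [G, Finset.notMem_erase, if_false]
          rw [map_smul, hzT (Finset.erase_subset j T.1) subset_rfl (Finset.insert_erase hj).symm,
            locMap_self, sgn_erase_self, smul_smul, ← Int.cast_mul, sgn_mul_self, Int.cast_one,
            one_smul, show F T.1 = f T from extendZero_coe f T, sub_self, map_zero]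
        · intro k hk hkj
          rw [hg T k hk]
          simp only [G, Finset.mem_erase, hkj.symm, hj, ne_eq, not_false_eq_true, and_self, if_true]
          simp
        · exact fun h => absurd hj h
      · rw [map_sub, map_smul, sub_eq_zero, map_sum]
        -- For `j ∉ T`, the cocycle condition at `T ∪ j` rewrites `f(T)` through the terms defining
        -- `dg`.
        have hd := congrFun hf ⟨insert j T.1, by rw [Finset.card_insert_of_notMem hj, T.2]⟩
        rw [cechD_apply_eq_sum, Finset.sum_insert hj,
          locMap_extendZero_congr x f (Finset.erase_insert hj) _ (Finset.subset_insert j T.1),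
          extendZero_coe, sgn_insert_self] at hd
        have hd' := congrArg (fun w => (sgn T.1 j : R) • w) hd
        simp only [Pi.zero_apply, smul_zero, smul_add] at hd'
        rw [smul_smul, ← Int.cast_mul, sgn_mul_self, Int.cast_one, one_smul] at hd'
        rw [eq_neg_of_add_eq_zero_left hd', Finset.smul_sum,
          ← Finset.sum_neg_distrib, Finset.smul_sum]
        refine Finset.sum_congr rfl fun k hk => ?_
        have hkj : k ≠ j := fun h => hj (h ▸ hk)
        rw [hg T k hk]
        simp only [G, Finset.mem_erase, hj, and_false, if_false]
        rw [map_smul, map_smul, map_smul, locMap_locMap,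
          hzT _ (Finset.erase_subset k (insert j T.1)) (Finset.erase_insert_of_ne hkj.symm)]
        have h := sgn_erase_swap (insert j T.1) (Finset.mem_insert_self j _)
          (Finset.mem_insert_of_mem hk) hkj.symm
        rw [Finset.erase_insert hj, Finset.erase_insert_of_ne hkj.symm, sgn_insert_self,
          sgn_insert_self] at h
        have h3 : sgn T.1 k * sgn (T.1.erase k) j = - (sgn T.1 j * sgn (insert j T.1) k) := by
          linear_combination (sgn T.1 j * sgn (T.1.erase k) j) * h
            - sgn T.1 k * sgn (T.1.erase k) j * sgn_mul_self T.1 j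
            - sgn T.1 j * sgn (insert j T.1) k * sgn_mul_self (T.1.erase k) j
        have h4 := congrArg (fun z : ℤ => (z : R)) h3
        push_cast at h4
        simp only [smul_smul, ← neg_smul]
        congr 1
        linear_combination x j ^ n * h4
  refine ⟨n' + n, x j ^ n' • g, ?_⟩
  rw [smul_sub, sub_eq_zero, smul_smul, ← pow_add] at hn'
  rw [map_smul, hn']

end Cech

/-! ### Čech cohomology modulo a regular element -/

section CechMap

open scoped Pointwise

variable {R : Type u} [CommRing R] {l : ℕ} (x : Fin l → R)
variable {M : Type v} [AddCommGroup M] [Module R M]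
variable {N : Type v} [AddCommGroup N] [Module R N]
variable {P : Type v} [AddCommGroup P] [Module R P]

/-- The map on localizations induced by a linear map. -/
noncomputable def locAtMap (φ : M →ₗ[R] N) (S : Finset (Fin l)) : LocAt x M S →ₗ[R] LocAt x N S :=
  IsLocalizedModule.map (Submonoid.powers (∏ j ∈ S, x j)) (LocalizedModule.mkLinearMap _ M)
    (LocalizedModule.mkLinearMap _ N) φ

lemma locAtMap_mkLinearMap (φ : M →ₗ[R] N) (S : Finset (Fin l)) (m : M) :
    locAtMap x φ S (LocalizedModule.mkLinearMap _ M m) = LocalizedModule.mkLinearMap _ N (φ m) :=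
  IsLocalizedModule.map_apply _ _ _ φ m

lemma locAtMap_exact (φ : M →ₗ[R] N) (ψ : N →ₗ[R] P) (h : Function.Exact φ ψ)
    (S : Finset (Fin l)) : Function.Exact (locAtMap x φ S) (locAtMap x ψ S) :=
  IsLocalizedModule.map_exact _ _ _ _ φ ψ h

lemma locAtMap_surjective (φ : M →ₗ[R] N) (h : Function.Surjective φ) (S : Finset (Fin l)) :
    Function.Surjective (locAtMap x φ S) :=
  IsLocalizedModule.map_surjective _ _ _ φ h

lemma locMap_locAtMap (φ : M →ₗ[R] N) {S T : Finset (Fin l)} (h : S ⊆ T) (z : LocAt x M S) :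
    locMap x N h (locAtMap x φ S z) = locAtMap x φ T (locMap x M h z) := by
  obtain ⟨n, m, hm⟩ := exists_smul_eq_mk x S z
  refine smul_locAt_injective x h n ?_
  rw [← map_smul, ← map_smul, hm, ← map_smul, ← map_smul, hm, locAtMap_mkLinearMap,
    locMap_mkLinearMap, locMap_mkLinearMap, locAtMap_mkLinearMap]

lemma cechD_map (φ : M →ₗ[R] N) {i : ℕ} (f : ∀ S : Idx l i, LocAt x M S.1) :
    cechD x N i (fun S : Idx l i => locAtMap x φ S.1 (f S)) =
      fun S : Idx l (i + 1) => locAtMap x φ S.1 (cechD x M i f S) := by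
  ext S
  rw [cechD_apply, cechD_apply, map_sum]
  refine Finset.sum_congr rfl fun j _ => ?_
  rw [map_smul, locMap_locAtMap]

lemma IsCechBoundary.map (φ : M →ₗ[R] N) {i : ℕ} {f : ∀ S : Idx l i, LocAt x M S.1}
    (h : IsCechBoundary x M i f) : IsCechBoundary x N i (fun S => locAtMap x φ S.1 (f S)) := by
  obtain _ | i := i
  · rw [show f = 0 from h]
    exact funext fun S => map_zero _
  · obtain ⟨g, rfl⟩ := h
    exact ⟨_, cechD_map x φ g⟩

lemma isSMulRegular_locAt {y : R} (h : IsSMulRegular M y) (S : Finset (Fin l)) :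
    IsSMulRegular (LocAt x M S) y := by
  rw [isSMulRegular_iff_right_eq_zero_of_smul]
  intro z hz
  obtain ⟨n, m, hm⟩ := exists_smul_eq_mk x S z
  have h0 : LocalizedModule.mkLinearMap (Submonoid.powers (∏ k ∈ S, x k)) M (y • m) = 0 := by
    rw [map_smul, ← hm, smul_comm, hz, smul_zero]
  rw [IsLocalizedModule.eq_zero_iff (Submonoid.powers (∏ k ∈ S, x k))] at h0
  obtain ⟨⟨s, hs⟩, h0⟩ := h0
  have h1 : s • m = 0 := h.right_eq_zero_of_smul (by rw [smul_comm]; exact h0)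
  refine smul_locAt_injective x subset_rfl n ?_
  rw [hm, smul_zero, IsLocalizedModule.eq_zero_iff (Submonoid.powers (∏ k ∈ S, x k))]
  exact ⟨⟨s, hs⟩, h1⟩

lemma exists_smul_of_locAtMap_mkQ_eq_zero {y : R} {S : Finset (Fin l)} {z : LocAt x M S}
    (h : locAtMap x (y • (⊤ : Submodule R M)).mkQ S z = 0) : ∃ w, y • w = z := by
  have hex : Function.Exact (LinearMap.lsmul R M y) (y • (⊤ : Submodule R M)).mkQ := fun m => by
    constructor
    · exact exists_smul_of_mk_eq_zero
    · rintro ⟨n, rfl⟩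
      exact mk_smul_eq_zero y n
  obtain ⟨w, rfl⟩ := (locAtMap_exact x _ _ hex S z).mp h
  refine ⟨w, ?_⟩
  obtain ⟨n, m, hm⟩ := exists_smul_eq_mk x S w
  refine smul_locAt_injective x subset_rfl n ?_
  rw [smul_comm, ← map_smul, hm, locAtMap_mkLinearMap, LinearMap.lsmul_apply, map_smul]

lemma locAtMap_mkQ_smul (y : R) {S : Finset (Fin l)} (z : LocAt x M S) :
    locAtMap x (y • (⊤ : Submodule R M)).mkQ S (y • z) = 0 := by
  obtain ⟨n, m, hm⟩ := exists_smul_eq_mk x S z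
  refine smul_locAt_injective x subset_rfl n ?_
  rw [← map_smul, smul_comm, hm, ← map_smul, locAtMap_mkLinearMap, smul_zero]
  exact (congrArg _ (mk_smul_eq_zero y m)).trans (map_zero _)

/-- Division by a non-zero-divisor on `M`, for cochains that vanish modulo `y`. -/
lemma exists_smul_eq_of_locAtMap_mkQ_eq_zero {y : R} {i : ℕ} (f : ∀ S : Idx l i, LocAt x M S.1)
    (h : (fun S : Idx l i => locAtMap x (y • (⊤ : Submodule R M)).mkQ S.1 (f S)) = 0) :
    ∃ g, y • g = f := by
  choose g hg using fun S => exists_smul_of_locAtMap_mkQ_eq_zero x (congrFun h S)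
  exact ⟨g, funext hg⟩

lemma smul_cochain_injective {y : R} (hy : IsSMulRegular M y) {i : ℕ}
    {f g : ∀ S : Idx l i, LocAt x M S.1} (h : y • f = y • g) : f = g :=
  funext fun S => isSMulRegular_locAt x hy S.1 (congrFun h S)

/-- This is injectivity of `y` on `H^i(M)`, read from the long exact sequence: the kernel is the
image of `H^{i-1}(M/yM)`, which vanishes. -/
lemma isCechBoundary_of_smul {y : R} (hy : IsSMulRegular M y) {i : ℕ}
    (hex : ∀ i', i' < i → CechExact x (QuotSMulTop y M) i')
    {f : ∀ S : Idx l i, LocAt x M S.1} (h : IsCechBoundary x M i (y • f)) :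
    IsCechBoundary x M i f := by
  obtain _ | i := i
  · exact smul_cochain_injective x hy (h.trans (smul_zero y).symm)
  obtain ⟨g, hg⟩ := h
  let π := (y • (⊤ : Submodule R M)).mkQ
  have hcyc : cechD x (QuotSMulTop y M) i (fun S => locAtMap x π S.1 (g S)) = 0 := by
    rw [cechD_map, hg]
    exact funext fun S => locAtMap_mkQ_smul x y (f S)
  -- The class of `g` modulo `y` is a coboundary, so it lifts to a cocycle `g₁` on `M`; then `g -
  -- g₁` is divisible by `y`.
  obtain ⟨g₁, hg₁, hdg₁⟩ : ∃ g₁, (fun S : Idx l i => locAtMap x π S.1 (g₁ S)) =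
      (fun S : Idx l i => locAtMap x π S.1 (g S)) ∧ cechD x M i g₁ = 0 := by
    have hb := hex i i.lt_succ_self _ hcyc
    obtain _ | i := i
    · exact ⟨0, by rw [show _ = _ from hb]; exact funext fun S => map_zero _, map_zero _⟩
    · obtain ⟨h', hh'⟩ := hb
      choose h hh using fun S : Idx l i =>
        locAtMap_surjective x π (Submodule.mkQ_surjective _) S.1 (h' S)
      refine ⟨cechD x M i h, ?_, ?_⟩
      · rw [← cechD_map, show (fun S : Idx l i => locAtMap x π S.1 (h S)) = h' from funext hh, hh']
      · rw [← LinearMap.comp_apply, cechD_comp, LinearMap.zero_apply]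
  obtain ⟨g', hg'⟩ := exists_smul_eq_of_locAtMap_mkQ_eq_zero x (y := y) (g - g₁) (by
    refine funext fun S => ?_
    rw [Pi.sub_apply, map_sub]
    exact sub_eq_zero.mpr (congrFun hg₁ S).symm)
  refine ⟨g', smul_cochain_injective x hy ?_⟩
  rw [← map_smul, hg', map_sub, hg, hdg₁, sub_zero]

/-- If a weakly regular sequence of length `k` consists of elements of `x`, then the Čech
cohomology vanishes in degrees less than `k`. -/
lemma cechExact_of_isWeaklyRegular (ys : List R) :
    ∀ {M : Type v} [AddCommGroup M] [Module R M],
      RingTheory.Sequence.IsWeaklyRegular M ys → (∀ y ∈ ys, y ∈ Set.range x) →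
      ∀ i, i < ys.length → CechExact x M i := by
  induction ys with
  | nil => intro M _ _ _ _ i hi; simp at hi
  | cons y ys ih =>
    intro M _ _ hreg hmem i hi f hf
    rw [RingTheory.Sequence.isWeaklyRegular_cons_iff] at hreg
    obtain ⟨j, rfl⟩ := hmem y (by simp)
    obtain ⟨n, hn⟩ := exists_isCechBoundary_pow_smul x j f hf
    -- Some `x_j ^ n` kills the class of `f`, and the regular element `x_j` acts injectively: its
    -- factors cancel one at a time.
    induction n with
    | zero => simpa using hn
    | succ n ihn =>
      rw [pow_succ', mul_smul] at hn
      exact ihn (isCechBoundary_of_smul x hreg.1 (fun i' hi' =>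
        ih hreg.2 (fun z hz => hmem z (by simp [hz])) i' (by simp at hi; omega)) hn)

/-- In the long exact sequence `H^i(M/yM)` lies between `H^i(M)` and `H^{i+1}(M)`. -/
lemma CechExact.quotSMulTop {y : R} (hy : IsSMulRegular M y) {i : ℕ} (h : CechExact x M i)
    (h' : CechExact x M (i + 1)) : CechExact x (QuotSMulTop y M) i := by
  intro f' hf'
  let π := (y • (⊤ : Submodule R M)).mkQ
  choose f hf using fun S : Idx l i =>
    locAtMap_surjective x π (Submodule.mkQ_surjective _) S.1 (f' S)
  have hff : (fun S : Idx l i => locAtMap x π S.1 (f S)) = f' := funext hf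
  obtain ⟨g, hg⟩ := exists_smul_eq_of_locAtMap_mkQ_eq_zero x (y := y) (cechD x M i f) (by
    rw [← cechD_map, ← hf', ← hff])
  obtain ⟨h₁, rfl⟩ := h' g (smul_cochain_injective x hy (by
    rw [← map_smul, hg, ← LinearMap.comp_apply, cechD_comp, LinearMap.zero_apply, smul_zero]))
  have hb := (h (f - y • h₁) (by rw [map_sub, map_smul, hg, sub_self])).map x π
  convert hb using 1
  rw [← hff]
  refine funext fun S => ?_
  rw [Pi.sub_apply, map_sub, Pi.smul_apply, locAtMap_mkQ_smul, sub_zero]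

/-- Such an `m` dies in every `M_{x_j}`, so it is a `0`-cocycle; localizing at the empty product `1`
loses nothing. -/
lemma CechExact.eq_zero_of_smul_eq_zero (h : CechExact x M 0) {m : M} (hm : ∀ j, x j • m = 0) :
    m = 0 := by
  have h0 := h (fun S => LocalizedModule.mkLinearMap _ M m) (by
    refine funext fun S => ?_
    rw [cechD_apply]
    refine Finset.sum_eq_zero fun j _ => ?_
    rw [locMap_mkLinearMap, (IsLocalizedModule.eq_zero_iff (Submonoid.powers (∏ k ∈ S.1, x k)) _).mpr, smul_zero]
    refine ⟨⟨∏ k ∈ S.1, x k, Submonoid.mem_powers _⟩, ?_⟩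
    change (∏ k ∈ S.1, x k) • m = 0
    rw [← Finset.prod_erase_mul _ _ j.2, mul_smul, hm, smul_zero])
  have h1 := congrFun h0 ⟨∅, rfl⟩
  obtain ⟨⟨_, n, rfl⟩, hn⟩ := (IsLocalizedModule.eq_zero_iff
    (Submonoid.powers (∏ j ∈ (∅ : Finset (Fin l)), x j)) _).mp h1
  have hn' : (∏ j ∈ (∅ : Finset (Fin l)), x j) ^ n • m = 0 := hn
  simpa using hn'

lemma mk_mem_ofList_smul_top_iff (y : R) (ys : List R) (m : M) :
    (Submodule.Quotient.mk m : QuotSMulTop y M) ∈ Ideal.ofList ys • (⊤ : Submodule R _) ↔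
      m ∈ Ideal.ofList (y :: ys) • (⊤ : Submodule R M) := by
  have h := Submodule.map_smul'' (Ideal.ofList ys) (⊤ : Submodule R M)
    (y • (⊤ : Submodule R M)).mkQ
  rw [Submodule.map_top, Submodule.range_mkQ] at h
  rw [← h, Ideal.ofList_cons_smul, ← Submodule.comap_map_mkQ]
  rfl

/-- If the Čech cohomology vanishes in degrees at most `k`, then no nonzero element of the quotient
by a weakly regular sequence of length `k` is annihilated by `x`. -/
lemma mem_of_forall_smul_mem (ys : List R) :
    ∀ {M : Type v} [AddCommGroup M] [Module R M],
      RingTheory.Sequence.IsWeaklyRegular M ys → (∀ i, i ≤ ys.length → CechExact x M i) →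
      ∀ m : M, (∀ j, x j • m ∈ Ideal.ofList ys • (⊤ : Submodule R M)) →
        m ∈ Ideal.ofList ys • (⊤ : Submodule R M) := by
  induction ys with
  | nil =>
    intro M _ _ _ hex m hm
    simp only [Ideal.ofList_nil, Submodule.bot_smul, Submodule.mem_bot] at hm ⊢
    exact (hex 0 (by simp)).eq_zero_of_smul_eq_zero x hm
  | cons y ys ih =>
    intro M _ _ hreg hex m hm
    rw [RingTheory.Sequence.isWeaklyRegular_cons_iff] at hreg
    rw [← mk_mem_ofList_smul_top_iff]
    refine ih hreg.2 (fun i hi => (hex i (by simp; omega)).quotSMulTop x hreg.1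
      (hex (i + 1) (by simpa using hi))) _ fun j => ?_
    exact (mk_mem_ofList_smul_top_iff y ys (x j • m)).mpr (hm j)

end CechMap

/-! ### Grade, polynomial grade and regularity for lists -/

section StrongParameterSequences

variable {R : Type u} [CommRing R]

lemma ofList_eq_span_range_get (xs : List R) : Ideal.ofList xs = Ideal.span (Set.range xs.get) := by
  rw [Set.range_list_get]

lemma isZero_koszulHomology_iff (M : Type v) [AddCommGroup M] [Module R M] (xs : List R) (i : ℕ) :
    Limits.IsZero (koszulHomology M xs (i + 1)) ↔ KoszulExact xs.get M (i + 1) :=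
  isZero_koszul_homology_iff _ _ _

lemma isZero_cechCohomology_iff (M : Type v) [AddCommGroup M] [Module R M] (xs : List R) (i : ℕ) :
    Limits.IsZero (cechCohomology M xs i) ↔ CechExact xs.get M i :=
  isZero_cech_homology_iff _ _ _

variable {M : Type v} [AddCommGroup M] [Module R M]

lemma IsStrongParameterSequence.take {xs : List R} (h : IsStrongParameterSequence M xs) (k : ℕ) :
    IsStrongParameterSequence M (xs.take k) := by
  intro i hi hik
  rw [List.length_take] at hik
  rw [List.take_take, min_eq_left (by omega)]
  exact h i hi (by omega)

lemma IsStrongParameterSequence.smul_ne_top [Nontrivial M] {xs : List R}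
    (h : IsStrongParameterSequence M xs) : Ideal.ofList xs • (⊤ : Submodule R M) ≠ ⊤ := by
  obtain rfl | hne := eq_or_ne xs []
  · simp [bot_ne_top]
  · have := (h xs.length (List.length_pos_iff.mpr hne) le_rfl).smul_ne_top
    rwa [List.take_length] at this

lemma IsRegularSequence.isWeaklyRegular {xs : List R} (h : IsRegularSequence M xs) :
    RingTheory.Sequence.IsWeaklyRegular M xs := by
  rcases h with rfl | h
  · simp
  · exact h.toIsWeaklyRegular

lemma classicalGrade_ofList_le (xs : List R) (h : Ideal.ofList xs • (⊤ : Submodule R M) ≠ ⊤) :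
    classicalGrade M (Ideal.ofList xs) ≤ xs.length := by
  rw [ofList_eq_span_range_get] at h ⊢
  exact classicalGrade_le _ h

lemma mem_ofList_of_mem {xs : List R} : ∀ y ∈ xs, y ∈ Ideal.ofList xs :=
  fun _ hy => Ideal.subset_span hy

/-- Flatness carries weakly regular sequences over, and faithful flatness preserves `xM ≠ M`, which
bounds the grade above. -/
lemma classicalGrade_baseChange (n : ℕ) {xs : List R}
    (h : Ideal.ofList xs • (⊤ : Submodule R M) ≠ ⊤)
    (hg : classicalGrade M (Ideal.ofList xs) = xs.length) :
    classicalGrade (R := MvPolynomial (Fin n) R) (MvPolynomial (Fin n) R ⊗[R] M)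
      ((Ideal.ofList xs).map (algebraMap R (MvPolynomial (Fin n) R))) = xs.length := by
  have : Nontrivial M := by
    by_contra hM
    rw [not_nontrivial_iff_subsingleton] at hM
    exact h (Subsingleton.elim _ _)
  have := Module.nontrivial R M
  have hb := TensorProduct.isBaseChange R M (MvPolynomial (Fin n) R)
  apply le_antisymm
  · have := (hb.map_smul_top_ne_top_iff_of_faithfullyFlat R M _).mpr h
    rw [Ideal.map_ofList] at this ⊢
    simpa using classicalGrade_ofList_le _ this
  · obtain ⟨ys, hmem, hreg, hlen⟩ := exists_isWeaklyRegular_of_le_classicalGrade hg.ge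
    refine le_trans ?_ (le_classicalGrade (ys := ys.map (algebraMap R _)) ?_
      (hreg.of_flat_of_isBaseChange hb))
    · simpa using hlen
    · intro y hy
      obtain ⟨z, hz, rfl⟩ := List.mem_map.mp hy
      exact Ideal.mem_map_of_mem _ (hmem z hz)

/-- Since the limit is the integer `ℓ`, some stage already has grade greater than `ℓ - 1`;
evaluation at `t = 0` then retracts to `R`. -/
lemma HasPolynomialGrade.koszulExact {xs : List R}
    (h : HasPolynomialGrade M (Ideal.ofList xs) xs.length) (i : ℕ) (hi : 1 ≤ i) :
    KoszulExact xs.get M i := by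
  obtain ⟨n, hn⟩ : ∃ n, (xs.length : ℕ∞) ≤ classicalGrade (R := MvPolynomial (Fin n) R)
      (MvPolynomial (Fin n) R ⊗[R] M)
      ((Ideal.ofList xs).map (algebraMap R (MvPolynomial (Fin n) R))) := by
    obtain hl | hl := Nat.eq_zero_or_pos xs.length
    · exact ⟨0, by simp [hl]⟩
    have hlt : ((xs.length - 1 : ℕ) : ℕ∞) < xs.length := by exact_mod_cast Nat.sub_lt hl one_pos
    obtain ⟨n, hn⟩ := (h.eventually (lt_mem_nhds hlt)).exists
    refine ⟨n, ?_⟩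
    have := Order.add_one_le_of_lt hn
    rwa [← Nat.cast_add_one, Nat.sub_add_cancel hl] at this
  obtain ⟨ys, hmem, hreg, hlen⟩ := exists_isWeaklyRegular_of_le_classicalGrade hn
  refine KoszulExact.of_baseChange xs.get
    (MvPolynomial.aeval (R := R) (0 : Fin n → R)).toLinearMap (by simp)
    (koszulExact_of_isWeaklyRegular _ ys hreg (fun y hy => ?_) i (by omega))
  have := hmem y hy
  rwa [ofList_eq_span_range_get, Ideal.map_span, ← Set.range_comp] at this

/-- If `H_1` vanishes for every initial segment of `xs`, then `xs` is weakly regular. -/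
lemma isWeaklyRegular_of_koszulExact_one {xs : List R}
    (h : ∀ k, KoszulExact (xs.take k).get M 1) : RingTheory.Sequence.IsWeaklyRegular M xs := by
  refine ⟨fun i hi => ?_⟩
  rw [isSMulRegular_iff_right_eq_zero_of_smul]
  intro z hz
  obtain ⟨m, rfl⟩ := Submodule.Quotient.mk_surjective _ z
  rw [← Submodule.Quotient.mk_smul, Submodule.Quotient.mk_eq_zero] at hz
  rw [Submodule.Quotient.mk_eq_zero]
  let a : Fin (xs.take (i + 1)).length := ⟨i, by simp; omega⟩
  have hspan : Ideal.span ((xs.take (i + 1)).get '' {j | j ≠ a}) = Ideal.ofList (xs.take i) := by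
    unfold Ideal.ofList
    congr 1
    ext r
    simp only [Set.mem_image, Set.mem_ofPred_eq, List.mem_iff_getElem]
    constructor
    · rintro ⟨⟨j, hj⟩, hne, rfl⟩
      have hne' : j ≠ i := fun e => hne (Fin.ext e)
      simp only [List.length_take] at hj
      exact ⟨j, by simp; omega, by simp⟩
    · rintro ⟨j, hj, rfl⟩
      simp only [List.length_take] at hj
      exact ⟨⟨j, by simp; omega⟩, fun e => by have := congrArg Fin.val e; simp [a] at this; omega,
        by simp⟩
  rw [← hspan] at hz ⊢
  exact (h (i + 1)).mem_of_smul_mem _ a (by simpa [a] using hz)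

/-- If the Čech cohomology of every initial segment of `xs` vanishes below the top degree, then
`xs` is weakly regular. -/
lemma isWeaklyRegular_of_cechExact {xs : List R}
    (h : ∀ k, ∀ i < (xs.take k).length, CechExact (xs.take k).get M i) :
    RingTheory.Sequence.IsWeaklyRegular M xs := by
  refine ⟨fun i => ?_⟩
  induction i using Nat.strong_induction_on with
  | _ i ih =>
    intro hi
    have hreg : RingTheory.Sequence.IsWeaklyRegular M (xs.take i) := ⟨fun k hk => by
      have hk' : k < i := by simp at hk; omega
      have := ih k hk' (by omega)
      rw [List.getElem_take, List.take_take, min_eq_left hk'.le]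
      exact this⟩
    rw [isSMulRegular_iff_right_eq_zero_of_smul]
    intro z hz
    obtain ⟨m, rfl⟩ := Submodule.Quotient.mk_surjective _ z
    rw [← Submodule.Quotient.mk_smul, Submodule.Quotient.mk_eq_zero] at hz
    rw [Submodule.Quotient.mk_eq_zero]
    -- If `xs[i]` sends `m` into `(x_j : j < i)M`, so does every element of the segment of length `i
    -- + 1`. Its Čech cohomology vanishes in degrees at most `i`, as needed for a weakly regular
    -- sequence of length `i`.
    refine mem_of_forall_smul_mem (xs.take (i + 1)).get _ hreg
      (fun k hk => h (i + 1) k (by simp at hk ⊢; omega)) m fun j => ?_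
    obtain ⟨j, hj⟩ := j
    simp only [List.length_take] at hj
    rcases (show j ≤ i by omega).eq_or_lt with rfl | hlt
    · simpa using hz
    · refine Submodule.smul_mem_smul (mem_ofList_of_mem _ ?_) trivial
      rw [List.mem_iff_getElem]
      exact ⟨j, by simp; omega, by simp⟩

end StrongParameterSequences

end NonNoethCM

/-! ### The equivalences -/

theorem mainTheorem3 {R : Type*} [CommRing R] {M : Type*} [AddCommGroup M] [Module R M]
    [Nontrivial M] :
    List.TFAE [
      NonNoethCM.IsCohenMacaulay R M,
      ∀ xs : List R, NonNoethCM.IsStrongParameterSequence M xs →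
        NonNoethCM.classicalGrade M (Ideal.ofList xs) = (xs.length : ℕ∞),
      ∀ xs : List R, NonNoethCM.IsStrongParameterSequence M xs →
        NonNoethCM.HasPolynomialGrade M (Ideal.ofList xs) (xs.length : ℕ∞),
      ∀ xs : List R, NonNoethCM.IsStrongParameterSequence M xs →
        ∀ i : ℕ, 1 ≤ i → CategoryTheory.Limits.IsZero (NonNoethCM.koszulHomology M xs i),
      ∀ xs : List R, NonNoethCM.IsStrongParameterSequence M xs →
        ∀ i : ℕ, i < xs.length →
          CategoryTheory.Limits.IsZero (NonNoethCM.cechCohomology M xs i)] := by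
  tfae_have 1 → 2 := fun h xs hxs =>
    le_antisymm (NonNoethCM.classicalGrade_ofList_le xs hxs.smul_ne_top)
      (NonNoethCM.le_classicalGrade NonNoethCM.mem_ofList_of_mem (h xs hxs).isWeaklyRegular)
  tfae_have 2 → 3 := fun h xs hxs => by
    unfold NonNoethCM.HasPolynomialGrade
    simp only [NonNoethCM.classicalGrade_baseChange _ hxs.smul_ne_top (h xs hxs)]
    exact tendsto_const_nhds
  tfae_have 3 → 4 := fun h xs hxs i hi => by
    obtain ⟨i, rfl⟩ := Nat.exists_eq_add_of_le' hi
    exact (NonNoethCM.isZero_koszulHomology_iff M xs i).mpr ((h xs hxs).koszulExact _ hi)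
  tfae_have 4 → 1 := fun h xs hxs => Or.inr
    ⟨NonNoethCM.isWeaklyRegular_of_koszulExact_one fun k =>
      (NonNoethCM.isZero_koszulHomology_iff M _ 0).mp (h _ (hxs.take k) 1 le_rfl),
      hxs.smul_ne_top.symm⟩
  tfae_have 1 → 5 := fun h xs hxs i hi =>
    (NonNoethCM.isZero_cechCohomology_iff M xs i).mpr
      (NonNoethCM.cechExact_of_isWeaklyRegular xs.get xs (h xs hxs).isWeaklyRegular
        (fun y hy => by rwa [Set.range_list_get]) i hi)
  tfae_have 5 → 1 := fun h xs hxs => Or.inr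
    ⟨NonNoethCM.isWeaklyRegular_of_cechExact fun k i hi =>
      (NonNoethCM.isZero_cechCohomology_iff M _ i).mp (h _ (hxs.take k) i hi),
      hxs.smul_ne_top.symm⟩
  tfae_finish
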